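/- Let $n\ge 2$, let $\mathbf s:\mathbb C^n\to\mathbb C^n$ be the map whose components are the elementary symmetric polynomials $s_1,\dots,s_n$, and put $\Gamma_n=\mathbf s(\overline{\mathbb D}^n)$ and $b\Gamma_n=\mathbf s(\mathbb T^n)$. All Hilbert spaces are complex, and $\sigma$ is the (Taylor) joint spectrum of a commuting tuple of bounded operators. A commuting tuple $(S_1,\dots,S_n)$ of bounded operators on a Hilbert space is a $\Gamma_n$-contraction if $\sigma(S_1,\dots,S_n)\subseteq\Gamma_n$ and $\|f(S_1,\dots,S_n)\|\le\sup_{\Gamma_n}|f|$ for every $f$ holomorphic on a neighbourhood of $\Gamma_n$. A $\Gamma_n$-unitary is a commuting tuple of normal operators with joint spectrum contained in $b\Gamma_n$. A $\Gamma_n$-isometry is the restriction of a $\Gamma_n$-unitary to a closed common invariant subspace. A $\Gamma_n$-isometric dilation of a $\Gamma_n$-contraction $(S_1,\dots,S_n)$ on $\mathcal H$ is a $\Gamma_n$-isometry $(V_1,\dots,V_n)$ on a Hilbert space $\mathcal K\supseteq\mathcal H$ such that $$P_{\mathcal H}V_1^{m_1}\cdots V_n^{m_n}|_{\mathcal H}=S_1^{m_1}\cdots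 S_n^{m_n}\qquad\text{for all integers } m_1,\dots,m_n\ge 0;$$ it is minimal if $\mathcal K=\overline{\operatorname{span}}\{V_1^{m_1}\cdots V_n^{m_n}h: h\in\mathcal H,\ m_1,\dots,m_n\ge 0\}$. **Proposition.** Let $(V_1,\dots,V_n)$, acting on $\mathcal K\supseteq\mathcal H$, be a $\Gamma_n$-isometric dilation of a $\Gamma_n$-contraction $(S_1,\dots,S_n)$ acting on $\mathcal H$, and let $$\mathcal K_0=\overline{\operatorname{span}}\{V_1^{m_1}\cdots V_n^{m_n}h: h\in\mathcal H,\ m_1,\dots,m_n\ge 0\}.$$ Then $\mathcal H\subseteq\mathcal K_0$, the subspace $\mathcal K_0$ is invariant under $V_1,\dots,V_n$, and $(V_1|_{\mathcal K_0},\dots,V_n|_{\mathcal K_0})$ is a minimal $\Gamma_n$-isometric dilation of $(S_1,\dots,S_n)$. -/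

import Mathlib

noncomputable section

namespace GammaDilation

universe u v

/-! ### The closed symmetrized polydisc -/

/-- The symmetrization map `𝐬 : ℂⁿ → ℂⁿ`. Coordinates are numbered from `0`, so the coordinate `i`
is the elementary symmetric function `s_{i+1}` of `z`. -/
def symmetrization (n : ℕ) (z : Fin n → ℂ) : Fin n → ℂ :=
  fun i => ∑ t ∈ Finset.powersetCard (i.val + 1) (Finset.univ : Finset (Fin n)), ∏ k ∈ t, z k

/-- The closed symmetrized polydisc `Γₙ`, the image of the closed polydisc. -/
def Gam (n : ℕ) : Set (Fin n → ℂ) :=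
  symmetrization n '' {z | ∀ k, ‖z k‖ ≤ 1}

/-- The distinguished boundary `bΓₙ`, the image of the torus `𝕋ⁿ`. -/
def bGam (n : ℕ) : Set (Fin n → ℂ) :=
  symmetrization n '' {z | ∀ k, ‖z k‖ = 1}

/-! ### Joint spectrum -/

section Spectrum

variable {n : ℕ} {H : Type u} [NormedAddCommGroup H] [InnerProductSpace ℂ H]

/-- The differential of the Koszul complex of `T` on `H ⊗ Λ(ℂⁿ)`. An element `∑_J x_J ⊗ e_J`
is written as the function `J ↦ x_J`, and `x ⊗ e_J` goes to `∑_j T_j x ⊗ (e_j ∧ e_J)`. All degrees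
are taken together; the map raises the degree `#J` by one. -/
def koszulDiff (T : Fin n → H →L[ℂ] H) (x : Finset (Fin n) → H) : Finset (Fin n) → H :=
  fun J => ∑ j ∈ J, (-1 : ℂ) ^ (J.filter (fun k => k < j)).card • T j (x (J.erase j))

/-- The (Taylor) joint spectrum of a commuting tuple: the points `lam` for which the Koszul complex
of `T - lam` is not exact. -/
def jointSpectrum (T : Fin n → H →L[ℂ] H) : Set (Fin n → ℂ) :=
  {lam | ¬ Function.Exact
    (koszulDiff fun j => T j - lam j • ContinuousLinearMap.id ℂ H)
    (koszulDiff fun j => T j - lam j • ContinuousLinearMap.id ℂ H)}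

end Spectrum

/-! ### Spectral sets and contractions -/

/-- The algebra of functions that are holomorphic on a neighbourhood of `Ω ⊆ ℂⁿ`. -/
def holoAlgebra {n : ℕ} (Ω : Set (Fin n → ℂ)) : Subalgebra ℂ ((Fin n → ℂ) → ℂ) where
  carrier := {f | AnalyticOnNhd ℂ f Ω}
  mul_mem' hf hg := AnalyticOnNhd.mul hf hg
  add_mem' hf hg := AnalyticOnNhd.add hf hg
  algebraMap_mem' c := analyticOnNhd_const (v := c)

/-- The coordinate function `z ↦ z i`, as a holomorphic function near `Ω`. -/
def holoCoord {n : ℕ} (Ω : Set (Fin n → ℂ)) (i : Fin n) : holoAlgebra Ω :=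
  ⟨fun z => z i, (ContinuousLinearMap.proj (R := ℂ) (φ := fun _ : Fin n => ℂ) i).analyticOnNhd Ω⟩

/-- `S` is a `Γₙ`-contraction: it is a commuting tuple, its joint spectrum lies in `Γₙ`, and the
holomorphic functional calculus `ρ : 𝒪(Γₙ) → B(H)` of `S` is contractive for the supremum norm on
`Γₙ`. A contractive unital homomorphism that takes the coordinate functions to the `S i` factors
through restriction to `Γₙ`, and, since `Γₙ` is polynomially convex, polynomials are dense in
`𝒪(Γₙ)`; hence there is at most one such `ρ`, and it is the holomorphic functional calculus. -/
def IsGammaContraction {n : ℕ} {H : Type u} [NormedAddCommGroup H] [InnerProductSpace ℂ H]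
    (S : Fin n → H →L[ℂ] H) : Prop :=
  (∀ i j, Commute (S i) (S j)) ∧
  jointSpectrum S ⊆ Gam n ∧
  ∃ ρ : holoAlgebra (Gam n) →ₐ[ℂ] (H →L[ℂ] H),
    (∀ i, ρ (holoCoord (Gam n) i) = S i) ∧
    ∀ f : holoAlgebra (Gam n), ‖ρ f‖ ≤ ⨆ z : Gam n, ‖f.1 z.1‖

/-! ### Unitaries and isometries -/

/-- `U` is a `Γₙ`-unitary: a commuting tuple of normal operators with joint spectrum in `bΓₙ`. -/
def IsGammaUnitary {n : ℕ} {K : Type v} [NormedAddCommGroup K] [InnerProductSpace ℂ K]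
    [CompleteSpace K] (U : Fin n → K →L[ℂ] K) : Prop :=
  (∀ i j, Commute (U i) (U j)) ∧ (∀ i, IsStarNormal (U i)) ∧ jointSpectrum U ⊆ bGam n

/-- `V` is a `Γₙ`-isometry: a commuting tuple that is the restriction of a `Γₙ`-unitary, acting on
a larger Hilbert space `L`, to a common invariant subspace. The inclusion of `K` into `L` is an
isometric embedding `ι`. -/
def IsGammaIsometry {n : ℕ} {K : Type v} [NormedAddCommGroup K] [InnerProductSpace ℂ K]
    (V : Fin n → K →L[ℂ] K) : Prop :=
  (∀ i j, Commute (V i) (V j)) ∧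
  ∃ (L : Type v) (_ : NormedAddCommGroup L) (_ : InnerProductSpace ℂ L) (_ : CompleteSpace L)
    (ι : K →ₗᵢ[ℂ] L) (U : Fin n → L →L[ℂ] L),
    IsGammaUnitary U ∧ ∀ i x, U i (ι x) = ι (V i x)

/-! ### Dilations -/

/-- The ordered product `V₁^{m₁} ⋯ Vₙ^{mₙ}`. -/
def monomial {n : ℕ} {K : Type v} [NormedAddCommGroup K] [InnerProductSpace ℂ K]
    (V : Fin n → K →L[ℂ] K) (m : Fin n → ℕ) : K →L[ℂ] K :=
  (List.ofFn fun i => V i ^ m i).prod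

/-- `V`, acting on `K`, is a `Γₙ`-isometric dilation of `S`, acting on `H`, where `H` is included
in `K` by the isometric embedding `ι`. The adjoint of `ι` is the orthogonal projection of `K` onto
`H`, so the last condition says `P_H V₁^{m₁} ⋯ Vₙ^{mₙ} |_H = S₁^{m₁} ⋯ Sₙ^{mₙ}`. -/
def IsGammaIsometricDilation {n : ℕ} {H : Type u} [NormedAddCommGroup H] [InnerProductSpace ℂ H]
    [CompleteSpace H] {K : Type v} [NormedAddCommGroup K] [InnerProductSpace ℂ K]
    [CompleteSpace K] (S : Fin n → H →L[ℂ] H) (ι : H →ₗᵢ[ℂ] K) (V : Fin n → K →L[ℂ] K) : Prop :=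
  IsGammaIsometry V ∧
  ∀ (m : Fin n → ℕ) (h : H),
    ContinuousLinearMap.adjoint ι.toContinuousLinearMap (monomial V m (ι h)) = monomial S m h

/-- The closed linear span of all `V₁^{m₁} ⋯ Vₙ^{mₙ} h` with `h ∈ H`. -/
abbrev dilationSpan {n : ℕ} {H : Type u} [NormedAddCommGroup H] [InnerProductSpace ℂ H]
    {K : Type v} [NormedAddCommGroup K] [InnerProductSpace ℂ K]
    (ι : H →ₗᵢ[ℂ] K) (V : Fin n → K →L[ℂ] K) : Submodule ℂ K :=
  (Submodule.span ℂ {x : K | ∃ (m : Fin n → ℕ) (h : H), x = monomial V m (ι h)}).topologicalClosure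

/-- A `Γₙ`-isometric dilation is minimal if its space is the closed span of all
`V₁^{m₁} ⋯ Vₙ^{mₙ} h` with `h ∈ H`. -/
def IsMinimalGammaIsometricDilation {n : ℕ} {H : Type u} [NormedAddCommGroup H]
    [InnerProductSpace ℂ H] [CompleteSpace H] {K : Type v} [NormedAddCommGroup K]
    [InnerProductSpace ℂ K] [CompleteSpace K]
    (S : Fin n → H →L[ℂ] H) (ι : H →ₗᵢ[ℂ] K) (V : Fin n → K →L[ℂ] K) : Prop :=
  IsGammaIsometricDilation S ι V ∧ dilationSpan ι V = ⊤

/-! ### Restrictions -/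

/-- The restriction of an operator to an invariant subspace. -/
def restrictOp {K : Type v} [NormedAddCommGroup K] [InnerProductSpace ℂ K]
    (A : K →L[ℂ] K) (M : Submodule ℂ K) (hA : ∀ x ∈ M, A x ∈ M) : M →L[ℂ] M :=
  (A.comp M.subtypeL).codRestrict M fun x => hA x.1 x.2

/-- An isometric embedding of `H` into `K`, seen as an embedding into a subspace that contains its
range. -/
def corestrict {H : Type u} [NormedAddCommGroup H] [InnerProductSpace ℂ H]
    {K : Type v} [NormedAddCommGroup K] [InnerProductSpace ℂ K]
    (ι : H →ₗᵢ[ℂ] K) (M : Submodule ℂ K) (hι : ∀ h, ι h ∈ M) : H →ₗᵢ[ℂ] M where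
  toLinearMap := ι.toLinearMap.codRestrict M hι
  norm_map' h := ι.norm_map h

end GammaDilation

end

namespace GammaDilation

universe u v

/-! The space `dilationSpan ι V` is the smallest closed subspace that contains `H` and is invariant
under every `V i`; commutativity gives the invariance. Any `Γₙ`-unitary extending `V` also extends
its restriction. The dilation identity survives because compressing to `H` gives the same operator
from the subspace as from `K`. Minimality holds because the generating vectors already lie in the
subspace, where their closed span is unchanged. -/

/-- Multiplying an ordered product of powers of commuting elements by one of these elements gives
another ordered product of powers. -/
theorem exists_mul_prod_ofFn_pow {M : Type*} [Monoid M] {n : ℕ} (a : Fin n → M)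
    (ha : ∀ i j, Commute (a i) (a j)) (i : Fin n) (m : Fin n → ℕ) :
    ∃ m' : Fin n → ℕ,
      a i * (List.ofFn fun k => a k ^ m k).prod = (List.ofFn fun k => a k ^ m' k).prod := by
  induction n with
  | zero => exact i.elim0
  | succ n ih =>
    induction i using Fin.cases with
    | zero =>
      refine ⟨Fin.cons (m 0 + 1) fun k => m k.succ, ?_⟩
      simp [List.ofFn_succ, pow_succ', mul_assoc]
    | succ j =>
      obtain ⟨m', hm'⟩ := ih (fun k => a k.succ) (fun _ _ => ha _ _) j fun k => m k.succ
      refine ⟨Fin.cons (m 0) m', ?_⟩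
      simp only [List.ofFn_succ, List.prod_cons, Fin.cons_zero, Fin.cons_succ]
      -- The factor `a j.succ` moves past the leading power of `a 0`, so that the inductive
      -- hypothesis absorbs it into the tail.
      rw [← hm', ← mul_assoc, ((ha j.succ 0).pow_right (m 0)).eq, mul_assoc]

section

variable {n : ℕ} {H : Type u} [NormedAddCommGroup H] [InnerProductSpace ℂ H]
  {K : Type v} [NormedAddCommGroup K] [InnerProductSpace ℂ K]

theorem monomial_zero (V : Fin n → K →L[ℂ] K) : monomial V 0 = 1 :=
  List.prod_eq_one fun _ hx => by
    obtain ⟨i, rfl⟩ := List.mem_ofFn.1 hx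
    simp

theorem monomial_mem_dilationSpan (ι : H →ₗᵢ[ℂ] K) (V : Fin n → K →L[ℂ] K)
    (m : Fin n → ℕ) (h : H) : monomial V m (ι h) ∈ dilationSpan ι V :=
  Submodule.le_topologicalClosure _ (Submodule.subset_span ⟨m, h, rfl⟩)

theorem range_subset_dilationSpan (ι : H →ₗᵢ[ℂ] K) (V : Fin n → K →L[ℂ] K) (h : H) :
    ι h ∈ dilationSpan ι V := by
  simpa [monomial_zero] using monomial_mem_dilationSpan ι V 0 h

theorem dilationSpan_invariant (ι : H →ₗᵢ[ℂ] K) (V : Fin n → K →L[ℂ] K)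
    (hV : ∀ i j, Commute (V i) (V j)) (i : Fin n) :
    ∀ x ∈ dilationSpan ι V, V i x ∈ dilationSpan ι V := by
  -- The preimage of a closed subspace under `V i` is closed, so only the generators need checking.
  have hle : dilationSpan ι V ≤ (dilationSpan ι V).comap (V i).toLinearMap := by
    refine Submodule.topologicalClosure_minimal _ (Submodule.span_le.2 ?_)
      ((Submodule.isClosed_topologicalClosure _).preimage (V i).continuous)
    rintro _ ⟨m, h, rfl⟩
    obtain ⟨m', hm'⟩ := exists_mul_prod_ofFn_pow V hV i m
    have key : V i (monomial V m (ι h)) = monomial V m' (ι h) := DFunLike.congr_fun hm' (ι h)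
    change V i (monomial V m (ι h)) ∈ dilationSpan ι V
    rw [key]
    exact monomial_mem_dilationSpan ι V m' h
  exact hle

theorem coe_restrictOp_pow (A : K →L[ℂ] K) (M : Submodule ℂ K) (hA : ∀ x ∈ M, A x ∈ M)
    (p : ℕ) (x : M) : ((restrictOp A M hA ^ p) x : K) = (A ^ p) x := by
  induction p generalizing x with
  | zero => rfl
  | succ p ih =>
    rw [pow_succ, pow_succ]
    exact ih _

theorem coe_monomial_restrictOp (V : Fin n → K →L[ℂ] K) (M : Submodule ℂ K)
    (hM : ∀ i, ∀ x ∈ M, V i x ∈ M) (m : Fin n → ℕ) (x : M) :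
    (monomial (fun i => restrictOp (V i) M (hM i)) m x : K) = monomial V m x := by
  unfold monomial
  induction n with
  | zero => simp
  | succ n ih =>
    simp only [List.ofFn_succ, List.prod_cons, mul_apply_eq_comp, coe_restrictOp_pow]
    rw [ih (fun i => V i.succ) (fun i => hM i.succ) fun i => m i.succ]

/-- The same unitary `U` serves, with the inclusion of `M` followed by the embedding of `K`; `M`
need not be closed for this. -/
theorem IsGammaIsometry.restrict {V : Fin n → K →L[ℂ] K} (hV : IsGammaIsometry V)
    (M : Submodule ℂ K) (hM : ∀ i, ∀ x ∈ M, V i x ∈ M) :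
    IsGammaIsometry fun i => restrictOp (V i) M (hM i) := by
  obtain ⟨hcomm, L, _, _, _, j, U, hU, hj⟩ := hV
  refine ⟨fun i k => ?_, L, inferInstance, inferInstance, inferInstance, j.comp M.subtypeₗᵢ, U,
    hU, fun i x => hj i x⟩
  ext x
  exact DFunLike.congr_fun (hcomm i k).eq (x : K)

theorem IsGammaIsometricDilation.restrict [CompleteSpace H] [CompleteSpace K]
    {S : Fin n → H →L[ℂ] H} {ι : H →ₗᵢ[ℂ] K} {V : Fin n → K →L[ℂ] K}
    (hV : IsGammaIsometricDilation S ι V) (M : Submodule ℂ K) [CompleteSpace M]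
    (hι : ∀ h, ι h ∈ M) (hM : ∀ i, ∀ x ∈ M, V i x ∈ M) :
    IsGammaIsometricDilation S (corestrict ι M hι) fun i => restrictOp (V i) M (hM i) := by
  refine ⟨hV.1.restrict M hM, fun m h => ?_⟩
  rw [← hV.2 m h]
  -- Paired with `g`, both sides become the inner product in `K` of `monomial V m (ι h)` with `ι g`.
  refine ext_inner_right ℂ fun g => ?_
  rw [ContinuousLinearMap.adjoint_inner_left, ContinuousLinearMap.adjoint_inner_left,
    Submodule.coe_inner, coe_monomial_restrictOp]
  rfl

theorem dilationSpan_restrictOp (ι : H →ₗᵢ[ℂ] K) (V : Fin n → K →L[ℂ] K)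
    (hι : ∀ h, ι h ∈ dilationSpan ι V)
    (hinv : ∀ i, ∀ x ∈ dilationSpan ι V, V i x ∈ dilationSpan ι V) :
    dilationSpan (corestrict ι (dilationSpan ι V) hι)
      (fun i => restrictOp (V i) (dilationSpan ι V) (hinv i)) = ⊤ := by
  set M := dilationSpan ι V with hMdef
  set N := dilationSpan (corestrict ι M hι) (fun i => restrictOp (V i) M (hinv i)) with hN
  have hNclosed : IsClosed (N : Set M) := Submodule.isClosed_topologicalClosure _
  have hMclosed : IsClosed (M : Set K) := Submodule.isClosed_topologicalClosure _
  -- Since `M` is closed in `K`, its inclusion is a closed map. The image of `N` is therefore closed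
  -- in `K`; it contains the generators of `M`, hence all of `M`.
  have hle : M ≤ N.map M.subtype := by
    refine Submodule.topologicalClosure_minimal _ (Submodule.span_le.2 ?_)
      (hMclosed.isClosedEmbedding_subtypeVal.isClosedMap _ hNclosed)
    rintro _ ⟨m, h, rfl⟩
    exact ⟨_, monomial_mem_dilationSpan (corestrict ι M hι) _ m h,
      coe_monomial_restrictOp V M hinv m _⟩
  refine eq_top_iff.2 fun x _ => ?_
  obtain ⟨y, hy, hyx⟩ := hle x.2
  rwa [← Subtype.ext hyx]

end

end GammaDilation

theorem proposition2p4 {n : ℕ} (hn : 2 ≤ n)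
    {H : Type*} [NormedAddCommGroup H] [InnerProductSpace ℂ H] [CompleteSpace H]
    {K : Type*} [NormedAddCommGroup K] [InnerProductSpace ℂ K] [CompleteSpace K]
    (S : Fin n → H →L[ℂ] H) (hS : GammaDilation.IsGammaContraction S)
    (ι : H →ₗᵢ[ℂ] K) (V : Fin n → K →L[ℂ] K)
    (hV : GammaDilation.IsGammaIsometricDilation S ι V) :
    ∃ (hι : ∀ h, ι h ∈ GammaDilation.dilationSpan ι V)
      (hinv : ∀ i, ∀ x ∈ GammaDilation.dilationSpan ι V,
        V i x ∈ GammaDilation.dilationSpan ι V),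
      GammaDilation.IsMinimalGammaIsometricDilation S
        (GammaDilation.corestrict ι (GammaDilation.dilationSpan ι V) hι)
        (fun i => GammaDilation.restrictOp (V i) (GammaDilation.dilationSpan ι V) (hinv i)) := by
  have hinv := GammaDilation.dilationSpan_invariant ι V hV.1.1
  have hι := GammaDilation.range_subset_dilationSpan ι V
  exact ⟨hι, hinv, hV.restrict _ hι hinv, GammaDilation.dilationSpan_restrictOp ι V hι hinv⟩
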